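/- Work over $\mathbb{C}$ with the Zariski topology. Let $m\ge 2$ and let $Y\subseteq\mathbb{P}^r$ be an irreducible closed subvariety of dimension $m$. Let $G(m-1,r)$ be the Grassmannian of $(m-1)$-dimensional linear subspaces of $\mathbb{P}^r$, with the Zariski topology of its Plücker embedding, and let $\mathcal{R}\subseteq G(m-1,r)$ be a $2$-dimensional family, that is, a subset (for instance a closed, locally closed or constructible one) whose Krull dimension in the subspace topology is $2$. If every linear space $\Lambda\in\mathcal{R}$ is contained in $Y$, then $Y$ is a linear subspace of $\mathbb{P}^r$. -/

import Mathlib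

open scoped LinearAlgebra.Projectivization

/-- A set of points is an algebraic set, with respect to homogeneous coordinates `c x` of the
points `x : X`, if it is the common zero locus of a set of homogeneous polynomials. (If the
coordinate vector of each point is fixed up to a nonzero scalar, the choice of that scalar does
not matter, as the polynomials are homogeneous.) -/
def IsAlgebraicSet {X σ : Type*} (c : X → σ → ℂ) (Z : Set X) : Prop :=
  ∃ S : Set (MvPolynomial σ ℂ), (∀ f ∈ S, ∃ d : ℕ, f.IsHomogeneous d) ∧
    Z = {x | ∀ f ∈ S, MvPolynomial.eval (c x) f = 0}

/-- The Zariski topology given by homogeneous coordinates: the closed sets are the algebraic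
sets. -/
@[reducible] def zariskiTopology {X σ : Type*} (c : X → σ → ℂ) : TopologicalSpace X :=
  TopologicalSpace.ofClosed {Z | IsAlgebraicSet c Z}
    (by
      refine ⟨{1}, ?_, ?_⟩
      · rintro f rfl
        exact ⟨0, MvPolynomial.isHomogeneous_one σ ℂ⟩
      · ext x
        simp)
    (by
      intro A hA
      refine ⟨{f | (∃ d : ℕ, f.IsHomogeneous d) ∧
        ∃ Z ∈ A, ∀ x ∈ Z, MvPolynomial.eval (c x) f = 0}, fun f hf => hf.1, ?_⟩
      ext x
      constructor
      · rintro hx f ⟨-, Z, hZ, hf⟩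
        exact hf x (hx Z hZ)
      · intro hx Z hZ
        obtain ⟨S, hS, rfl⟩ := hA hZ
        exact fun f hf => hx f ⟨hS f hf, _, hZ, fun y hy => hy f hf⟩)
    (by
      rintro _ ⟨S, hS, rfl⟩ _ ⟨T, hT, rfl⟩
      refine ⟨{h | ∃ f ∈ S, ∃ g ∈ T, h = f * g}, ?_, ?_⟩
      · rintro _ ⟨f, hf, g, hg, rfl⟩
        obtain ⟨d, hd⟩ := hS f hf
        obtain ⟨e, he⟩ := hT g hg
        exact ⟨d + e, hd.mul he⟩
      · ext x
        constructor
        · rintro (hx | hx) _ ⟨f, hf, g, hg, rfl⟩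
          · simp [hx f hf]
          · simp [hx g hg]
        · intro hx
          by_contra hcon
          simp only [Set.mem_union, Set.mem_ofPred_eq, not_or, not_forall] at hcon
          obtain ⟨⟨f, hf, hfx⟩, ⟨g, hg, hgx⟩⟩ := hcon
          have := hx _ ⟨f, hf, g, hg, rfl⟩
          rw [map_mul] at this
          exact (mul_ne_zero hfx hgx) this)

/-- The complex projective space `ℙ^r`. -/
abbrev ProjSpace (r : ℕ) : Type := ℙ ℂ (Fin (r + 1) → ℂ)

/-- The Zariski topology of `ℙ^r`. -/
noncomputable instance ProjSpace.instZariski (r : ℕ) : TopologicalSpace (ProjSpace r) :=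
  zariskiTopology (fun p : ProjSpace r => p.rep)

/-- The projective linear subspace of `ℙ^r` cut out by a vector subspace `L`; its dimension is
`finrank L - 1`. -/
def linearSpace {r : ℕ} (L : Submodule ℂ (Fin (r + 1) → ℂ)) : Set (ProjSpace r) :=
  {p | p.submodule ≤ L}

/-- The Grassmannian `G(m - 1, r)` of linear spaces of projective dimension `m - 1` in `ℙ^r`,
that is, of vector subspaces of `ℂ^(r+1)` of dimension `m`. -/
def ProjGrassmannian (m r : ℕ) : Type :=
  {W : Submodule ℂ (Fin (r + 1) → ℂ) // Module.finrank ℂ W = m}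

/-- The linear space in `ℙ^r` that a point of the Grassmannian stands for. -/
def ProjGrassmannian.space {m r : ℕ} (W : ProjGrassmannian m r) : Set (ProjSpace r) :=
  linearSpace W.1

/-- A basis of the `m`-dimensional vector subspace `W`. -/
noncomputable def ProjGrassmannian.frame {m r : ℕ} (W : ProjGrassmannian m r) :
    Fin m → Fin (r + 1) → ℂ :=
  fun i => (Module.finBasisOfFinrankEq ℂ W.1 W.2 i : Fin (r + 1) → ℂ)

/-- The Plücker coordinates of `W`: the `m × m` minors of the matrix whose rows are a basis of
`W`. They are indexed by all `m`-tuples of columns, hence are skew-symmetric in the index.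
Another basis of `W` multiplies all of them by the same nonzero scalar. -/
noncomputable def ProjGrassmannian.plucker {m r : ℕ} (W : ProjGrassmannian m r)
    (I : Fin m → Fin (r + 1)) : ℂ :=
  Matrix.det (Matrix.of fun i j : Fin m => W.frame i (I j))

/-- The Zariski topology of the Grassmannian, as a subvariety of a projective space in its
Plücker embedding. -/
noncomputable instance ProjGrassmannian.instZariski (m r : ℕ) :
    TopologicalSpace (ProjGrassmannian m r) :=
  zariskiTopology ProjGrassmannian.plucker

/-!
An irreducible subfamily of `R` with more than one member sweeps out a dense subset of `Y`: the
closure of the union is irreducible, and it strictly contains a linear space of dimension `m - 1`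
(`ProjGrassmannian.subset_closure_iUnion_space`). If moreover all members contain a point `p`, then
`Y` is a cone with vertex `p` (`mem_vertexSpace_of_subset_closure`). The vertices of `Y` form a
linear subspace contained in `Y`, so the point is to show that it is all of `Y`.

Otherwise its dimension is less than `m`, and there are `m` linear forms whose common zero set `N`
meets `Y` in finitely many points and contains no vertex of `Y` (`exists_commonZeros_dimLT`). For a
linear space `W` of dimension `m - 1`, meeting `N` is one linear condition on the Plücker
coordinates (`ProjGrassmannian.det_dotProduct_frame`). As the closure of `R` has dimension at least
two and the Grassmannian is closed in its Plücker embedding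
(`ProjGrassmannian.exists_eq_smul_plucker`), Krull's height theorem shows that infinitely many
members of this closure satisfy the condition (`infinite_inter_hyperplane`). They are contained in
`Y`, because containment in `Y` is a closed condition
(`ProjGrassmannian.isClosed_setOf_space_subset`), so each of them contains one of the finitely many
points of `Y ∩ N`. Hence some point of `Y ∩ N` lies on all members of an infinite irreducible
subfamily, and is a vertex of `Y` in `N`: a contradiction.
-/

/-! ### Polynomials on lines through the origin -/

open MvPolynomial in
theorem eval_smul_of_isHomogeneous {σ : Type*} {f : MvPolynomial σ ℂ} {d : ℕ}
    (hf : f.IsHomogeneous d) (t : ℂ) (x : σ → ℂ) : eval (t • x) f = t ^ d * eval x f := by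
  rw [eval_eq, eval_eq, Finset.mul_sum]
  refine Finset.sum_congr rfl fun e he => ?_
  simp only [Pi.smul_apply, smul_eq_mul, mul_pow, Finset.prod_mul_distrib,
    Finset.prod_pow_eq_pow_sum, hf.degree_eq_sum_deg_support he]
  ring

open MvPolynomial in
/-- On the line through `x`, a polynomial restricts to a univariate polynomial whose coefficients
are the values at `x` of its homogeneous components. -/
theorem exists_polynomial_eval_smul {σ : Type*} (f : MvPolynomial σ ℂ) (x : σ → ℂ) :
    ∃ q : Polynomial ℂ, (∀ t : ℂ, eval (t • x) f = q.eval t) ∧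
      ∀ d, q.coeff d = eval x (homogeneousComponent d f) := by
  classical
  refine ⟨∑ d ∈ Finset.range (f.totalDegree + 1),
    Polynomial.monomial d (eval x (homogeneousComponent d f)), fun t => ?_, fun d => ?_⟩
  · conv_lhs => rw [← sum_homogeneousComponent f]
    rw [map_sum, Polynomial.eval_finsetSum]
    refine Finset.sum_congr rfl fun d _ => ?_
    rw [Polynomial.eval_monomial, mul_comm,
      eval_smul_of_isHomogeneous (homogeneousComponent_isHomogeneous d f)]
  · rw [Polynomial.finsetSum_coeff]
    simp only [Polynomial.coeff_monomial]
    rw [Finset.sum_ite_eq']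
    split_ifs with h
    · rfl
    · rw [homogeneousComponent_eq_zero _ _ (by simpa using h), map_zero]

open MvPolynomial in
theorem forall_eval_smul_eq_zero_iff {σ : Type*} (f : MvPolynomial σ ℂ) (x : σ → ℂ) :
    (∀ t : ℂ, eval (t • x) f = 0) ↔ ∀ d, eval x (homogeneousComponent d f) = 0 := by
  obtain ⟨q, hq, hc⟩ := exists_polynomial_eval_smul f x
  simp only [hq, ← hc]
  constructor
  · intro h d
    rw [Polynomial.funext (p := q) (q := 0) (by simpa using h), Polynomial.coeff_zero]
  · intro h t
    rw [Polynomial.ext (p := q) (q := 0) (by simpa using h), Polynomial.eval_zero]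

open MvPolynomial in
theorem exists_eval_smul_ne_zero {σ : Type*} {f g : MvPolynomial σ ℂ} {x : σ → ℂ}
    (hf : ∃ t : ℂ, eval (t • x) f ≠ 0) (hg : ∃ t : ℂ, eval (t • x) g ≠ 0) :
    ∃ t : ℂ, eval (t • x) (f * g) ≠ 0 := by
  obtain ⟨p, hp, -⟩ := exists_polynomial_eval_smul f x
  obtain ⟨q, hq, -⟩ := exists_polynomial_eval_smul g x
  simp only [map_mul, hp, hq] at hf hg ⊢
  by_contra! h
  have : p * q = 0 := Polynomial.funext fun t => by simpa using h t
  rcases mul_eq_zero.1 this with rfl | rfl <;> simp at hf hg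

/-- The linear form with coefficient vector `a`. -/
noncomputable def linearForm {σ : Type*} [Fintype σ] (a : σ → ℂ) : MvPolynomial σ ℂ :=
  ∑ i, MvPolynomial.C (a i) * MvPolynomial.X i

theorem eval_linearForm {σ : Type*} [Fintype σ] (a x : σ → ℂ) :
    MvPolynomial.eval x (linearForm a) = a ⬝ᵥ x := by
  simp [linearForm, dotProduct]

theorem isHomogeneous_linearForm {σ : Type*} [Fintype σ] (a : σ → ℂ) :
    (linearForm a).IsHomogeneous 1 :=
  MvPolynomial.IsHomogeneous.sum _ _ _ fun i _ => MvPolynomial.isHomogeneous_C_mul_X (a i) i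

theorem exists_forall_dotProduct_ne_zero {σ ι : Type*} [Fintype σ] [Finite ι] (v : ι → σ → ℂ)
    (hv : ∀ i, v i ≠ 0) : ∃ a : σ → ℂ, ∀ i, a ⬝ᵥ v i ≠ 0 := by
  classical
  obtain ⟨f, hf⟩ := Module.exists_dual_forall_apply_ne_zero (K := ℂ) v hv
  obtain ⟨a, rfl⟩ := (dotProductEquiv ℂ σ).surjective f
  exact ⟨a, hf⟩

/-! ### Zariski topologies -/

theorem isClosed_zariskiTopology {X σ : Type*} (c : X → σ → ℂ) (Z : Set X) :
    @IsClosed X (zariskiTopology c) Z ↔ IsAlgebraicSet c Z := by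
  rw [← @isOpen_compl_iff X Z (zariskiTopology c)]
  change Zᶜᶜ ∈ {Z | IsAlgebraicSet c Z} ↔ _
  rw [compl_compl]; rfl

/-- The common zeros of arbitrary polynomials on the lines through the points form a closed set:
the condition amounts to the vanishing of all homogeneous components. -/
theorem isAlgebraicSet_forall_eval_smul {X σ : Type*} (c : X → σ → ℂ)
    (S : Set (MvPolynomial σ ℂ)) :
    IsAlgebraicSet c {x | ∀ f ∈ S, ∀ t : ℂ, MvPolynomial.eval (t • c x) f = 0} := by
  refine ⟨{g | ∃ f ∈ S, ∃ d, g = MvPolynomial.homogeneousComponent d f}, ?_, ?_⟩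
  · rintro _ ⟨f, -, d, rfl⟩
    exact ⟨d, MvPolynomial.homogeneousComponent_isHomogeneous d f⟩
  · ext x
    simp only [forall_eval_smul_eq_zero_iff, Set.mem_ofPred_eq]
    constructor
    · rintro h _ ⟨f, hf, d, rfl⟩
      exact h f hf d
    · exact fun h f hf d => h _ ⟨f, hf, d, rfl⟩

theorem isAlgebraicSet_of_isHomogeneous {X σ : Type*} (c : X → σ → ℂ) {f : MvPolynomial σ ℂ}
    {d : ℕ} (hf : f.IsHomogeneous d) :
    IsAlgebraicSet c {x | MvPolynomial.eval (c x) f = 0} :=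
  ⟨{f}, by simpa using ⟨d, hf⟩, by simp⟩

/-- The ideal of the affine cone over a set of points given by homogeneous coordinates. -/
noncomputable def coneIdeal {X σ : Type*} (c : X → σ → ℂ) (Z : Set X) :
    Ideal (MvPolynomial σ ℂ) :=
  MvPolynomial.vanishingIdeal ℂ {v | ∃ x ∈ Z, ∃ t : ℂ, v = t • c x}

section Cone

variable {X σ : Type*} {c : X → σ → ℂ}

theorem mem_coneIdeal {Z : Set X} {f : MvPolynomial σ ℂ} :
    f ∈ coneIdeal c Z ↔ ∀ x ∈ Z, ∀ t : ℂ, MvPolynomial.eval (t • c x) f = 0 := by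
  simp only [coneIdeal, MvPolynomial.mem_vanishingIdeal_iff, Set.mem_ofPred_eq,
    MvPolynomial.aeval_eq_eval]
  exact ⟨fun h x hx t => h _ ⟨x, hx, t, rfl⟩, by rintro h _ ⟨x, hx, t, rfl⟩; exact h x hx t⟩

theorem coneIdeal_anti {Z Z' : Set X} (h : Z ⊆ Z') : coneIdeal c Z' ≤ coneIdeal c Z :=
  fun _ hf => mem_coneIdeal.2 fun x hx => mem_coneIdeal.1 hf x (h hx)

theorem mem_coneIdeal_of_isHomogeneous {Z : Set X} {f : MvPolynomial σ ℂ} {d : ℕ}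
    (hf : f.IsHomogeneous d) (h : ∀ x ∈ Z, MvPolynomial.eval (c x) f = 0) :
    f ∈ coneIdeal c Z :=
  mem_coneIdeal.2 fun x hx t => by rw [eval_smul_of_isHomogeneous hf, h x hx, mul_zero]

/-- A closed set is recovered from the ideal of its cone, by testing at any nonzero multiple of the
coordinates of a point. -/
theorem IsAlgebraicSet.mem_iff {Z : Set X} (hZ : IsAlgebraicSet c Z) {x : X} {t : ℂ}
    (ht : t ≠ 0) : x ∈ Z ↔ ∀ f ∈ coneIdeal c Z, MvPolynomial.eval (t • c x) f = 0 := by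
  refine ⟨fun hx f hf => mem_coneIdeal.1 hf x hx t, fun h => ?_⟩
  obtain ⟨S, hS, rfl⟩ := hZ
  intro f hf
  obtain ⟨d, hd⟩ := hS f hf
  have := h f (mem_coneIdeal_of_isHomogeneous hd fun y hy => hy f hf)
  rw [eval_smul_of_isHomogeneous hd] at this
  exact (mul_eq_zero.1 this).resolve_left (pow_ne_zero _ ht)

theorem IsAlgebraicSet.subset_of_coneIdeal_le {Z Z' : Set X} (hZ : IsAlgebraicSet c Z)
    (h : coneIdeal c Z ≤ coneIdeal c Z') : Z' ⊆ Z := fun _ hx =>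
  (hZ.mem_iff one_ne_zero).2 fun _ hf => mem_coneIdeal.1 (h hf) _ hx 1

variable [TopologicalSpace X]

theorem coneIdeal_lt (hc : ∀ Z : Set X, IsClosed Z ↔ IsAlgebraicSet c Z)
    {Z Z' : Set X} (hZ : IsClosed Z) (h : Z ⊂ Z') :
    coneIdeal c Z' < coneIdeal c Z :=
  lt_of_le_not_ge (coneIdeal_anti h.1) fun h' => h.2 (((hc Z).1 hZ).subset_of_coneIdeal_le h')

theorem coneIdeal_isPrime (hc : ∀ Z : Set X, IsClosed Z ↔ IsAlgebraicSet c Z)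
    {Z : Set X} (hZ : IsIrreducible Z) : (coneIdeal c Z).IsPrime := by
  refine Ideal.isPrime_iff.2 ⟨fun h => ?_, fun {f g} hfg => ?_⟩
  · obtain ⟨x, hx⟩ := hZ.nonempty
    have h1 : (1 : MvPolynomial σ ℂ) ∈ coneIdeal c Z := h ▸ Submodule.mem_top
    simpa using mem_coneIdeal.1 h1 x hx 1
  · have hcl : ∀ f, IsClosed {x | ∀ t : ℂ, MvPolynomial.eval (t • c x) f = 0} := fun f => by
      rw [hc]; simpa using isAlgebraicSet_forall_eval_smul c {f}
    have := isPreirreducible_iff_isClosed_union_isClosed.1 hZ.2 _ _ (hcl f) (hcl g) fun x hx => by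
      by_contra! h
      simp only [Set.mem_union, Set.mem_ofPred_eq, not_or, not_forall] at h
      obtain ⟨t, ht⟩ := exists_eval_smul_ne_zero h.1 h.2
      exact ht (mem_coneIdeal.1 hfg x hx t)
    exact this.imp (fun h => mem_coneIdeal.2 fun x hx => h hx)
      fun h => mem_coneIdeal.2 fun x hx => h hx

theorem noetherianSpace_of_isAlgebraicSet [Finite σ]
    (hc : ∀ Z : Set X, IsClosed Z ↔ IsAlgebraicSet c Z) : TopologicalSpace.NoetherianSpace X := by
  refine ((TopologicalSpace.noetherianSpace_TFAE X).out 0 1 rfl rfl).2 ?_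
  have : StrictAnti fun Z : TopologicalSpace.Closeds X => coneIdeal c (Z : Set X) :=
    fun Z Z' h => coneIdeal_lt hc Z.isClosed h
  exact ⟨(wellFounded_gt (α := Ideal (MvPolynomial σ ℂ))).onFun.mono fun _ _ h => this h⟩

end Cone

/-! ### Linear sections of projective varieties of dimension at least two -/

/-- A form of Krull's height theorem: modulo a prime ideal, a prime ideal that is minimal over two
elements has height at most two. -/
theorem Ideal.notMem_minimalPrimes_sup_span_pair {A : Type*} [CommRing A] [IsNoetherianRing A]
    {p₀ p₁ p₂ p₃ : Ideal A} [p₀.IsPrime] [p₁.IsPrime] [p₂.IsPrime] [p₃.IsPrime]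
    (h₀₁ : p₀ < p₁) (h₁₂ : p₁ < p₂) (h₂₃ : p₂ < p₃) (f g : A) :
    p₃ ∉ (p₀ ⊔ Ideal.span {f, g}).minimalPrimes := by
  intro hmin
  let π := Ideal.Quotient.mk p₀
  have hπ : Function.Surjective π := Ideal.Quotient.mk_surjective
  have hker : RingHom.ker π = p₀ := Ideal.mk_ker
  have hcomap : ∀ q : Ideal A, p₀ ≤ q → (q.map π).comap π = q := fun q hq => by
    rw [Ideal.comap_map_of_surjective π hπ, ← RingHom.ker_eq_comap_bot, hker, sup_eq_left.2 hq]
  have hlt : ∀ q q' : Ideal A, p₀ ≤ q → q < q' → q.map π < q'.map π := fun q q' hq h =>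
    lt_of_le_not_ge (Ideal.map_mono h.le) fun h' => h.not_ge <| by
      rw [← hcomap q hq, ← hcomap q' (hq.trans h.le)]; exact Ideal.comap_mono h'
  have hprime : ∀ q : Ideal A, p₀ ≤ q → q.IsPrime → (q.map π).IsPrime := fun q hq _ =>
    Ideal.map_isPrime_of_surjective hπ (by rwa [hker])
  have := hprime p₀ le_rfl inferInstance
  have := hprime p₁ h₀₁.le inferInstance
  have := hprime p₂ (h₀₁.trans h₁₂).le inferInstance
  have := hprime p₃ ((h₀₁.trans h₁₂).trans h₂₃).le inferInstance
  have h1 := Ideal.height_strict_mono_of_isPrime_of_isPrime (hlt p₀ p₁ le_rfl h₀₁)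
  have h2 := Ideal.height_strict_mono_of_isPrime_of_isPrime (hlt p₁ p₂ h₀₁.le h₁₂)
  have h3 := Ideal.height_strict_mono_of_isPrime_of_isPrime
    (hlt p₂ p₃ (h₀₁.trans h₁₂).le h₂₃)
  have h4 : p₃.map π ∈ (Ideal.span {π f, π g}).minimalPrimes := by
    have h5 : (Ideal.span {f, g}).map π = Ideal.span {π f, π g} := by
      rw [Ideal.map_span, Set.image_pair]
    rw [← h5, Ideal.minimalPrimes_map_of_surjective hπ, hker, sup_comm]
    exact ⟨p₃, hmin, rfl⟩
  have h6 := (Ideal.height_le_card_of_mem_minimalPrimes_span (Set.toFinite _) h4).trans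
    (Nat.cast_le.2 ((Set.ncard_insert_le _ _).trans_eq
      (congrArg (· + 1) (Set.ncard_singleton (π g)))))
  have h7 := Order.add_one_le_of_lt h1
  have h8 := Order.add_one_le_of_lt (h7.trans_lt h2)
  have h9 := Order.add_one_le_of_lt (h8.trans_lt h3)
  have h10 : (3 : ℕ∞) ≤ 2 := by
    refine le_trans ?_ (h9.trans h6)
    have : (3 : ℕ∞) = 0 + 1 + 1 + 1 := by norm_num
    rw [this]
    gcongr
    exact bot_le
  exact absurd h10 (by decide)

/-- A hyperplane section of a projective variety of dimension at least two is infinite. Otherwise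
a second hyperplane would miss it, and the vertex of the affine cone would be cut out on the cone by
two equations, while the three irreducible closed sets below give its ideal height at least three.
The hypothesis `hcone` says that the points with the coordinates `c` form a closed subset of
projective space. -/
theorem infinite_inter_hyperplane {X σ : Type*} [Fintype σ] {c : X → σ → ℂ} [TopologicalSpace X]
    (hc : ∀ Z : Set X, IsClosed Z ↔ IsAlgebraicSet c Z) (hc0 : ∀ x, c x ≠ 0)
    (hcone : ∀ v : σ → ℂ, v ≠ 0 →
      (∀ f ∈ coneIdeal c Set.univ, MvPolynomial.eval v f = 0) → ∃ x, ∃ t : ℂ, v = t • c x)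
    {Z₀ Z₁ Z₂ : TopologicalSpace.IrreducibleCloseds X} (h₀₁ : Z₀ < Z₁) (h₁₂ : Z₁ < Z₂)
    (a : σ → ℂ) : {x | x ∈ Z₂ ∧ a ⬝ᵥ c x = 0}.Infinite := by
  intro hfin
  have : Finite {x | x ∈ Z₂ ∧ a ⬝ᵥ c x = 0} := hfin
  obtain ⟨b, hb⟩ := exists_forall_dotProduct_ne_zero
    (fun x : {x | x ∈ Z₂ ∧ a ⬝ᵥ c x = 0} => c x) fun x => hc0 x
  have := coneIdeal_isPrime hc Z₀.isIrreducible
  have := coneIdeal_isPrime hc Z₁.isIrreducible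
  have := coneIdeal_isPrime hc Z₂.isIrreducible
  have hmax : (MvPolynomial.vanishingIdeal ℂ {(0 : σ → ℂ)}).IsMaximal :=
    MvPolynomial.isMaximal_iff_eq_vanishingIdeal_singleton.2 ⟨0, rfl⟩
  have := hmax.isPrime
  have hle : ∀ Z : TopologicalSpace.IrreducibleCloseds X,
      coneIdeal c (Z : Set X) ≤ MvPolynomial.vanishingIdeal ℂ {(0 : σ → ℂ)} := fun Z => by
    obtain ⟨x, hx⟩ := Z.isIrreducible.nonempty
    refine MvPolynomial.vanishingIdeal_anti_mono ?_
    rintro _ rfl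
    exact ⟨x, hx, 0, by simp⟩
  have hlt : coneIdeal c (Z₀ : Set X) < MvPolynomial.vanishingIdeal ℂ {(0 : σ → ℂ)} := by
    refine lt_of_le_not_ge (hle _) fun h => ?_
    obtain ⟨x, hx⟩ := Z₀.isIrreducible.nonempty
    refine hc0 x (funext fun i => ?_)
    have := mem_coneIdeal.1 (h (x := MvPolynomial.X i) (by simp)) x hx 1
    simpa using this
  refine Ideal.notMem_minimalPrimes_sup_span_pair (coneIdeal_lt hc Z₁.isClosed h₁₂)
    (coneIdeal_lt hc Z₀.isClosed h₀₁) hlt (linearForm a) (linearForm b)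
    ⟨⟨inferInstance, sup_le (hle _) ?_⟩, ?_⟩
  · rw [Ideal.span_le]
    rintro _ (rfl | rfl) <;> simp [MvPolynomial.aeval_eq_eval, eval_linearForm]
  · rintro P ⟨hP, hPle⟩ -
    rw [sup_le_iff, Ideal.span_le] at hPle
    rw [← MvPolynomial.IsPrime.vanishingIdeal_zeroLocus (K := ℂ) P]
    refine MvPolynomial.vanishingIdeal_anti_mono fun v hv => ?_
    rw [MvPolynomial.mem_zeroLocus_iff] at hv
    simp only [MvPolynomial.aeval_eq_eval] at hv
    by_contra hv0
    obtain ⟨x, t, rfl⟩ := hcone v hv0 fun f hf =>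
      hv f (hPle.1 (coneIdeal_anti (Set.subset_univ _) hf))
    have ht : t ≠ 0 := by rintro rfl; simp at hv0
    have hx : x ∈ Z₂ := (((hc _).1 Z₂.isClosed).mem_iff ht).2 fun f hf => hv f (hPle.1 hf)
    have hax := hv _ (hPle.2 (Set.mem_insert _ _))
    have hbx := hv _ (hPle.2 (Set.mem_insert_of_mem _ rfl))
    rw [eval_linearForm, dotProduct_smul, smul_eq_zero, or_iff_right ht] at hax hbx
    exact hb ⟨x, hx, hax⟩ hbx

/-! ### Dimension of closed sets -/

section Dimension

open TopologicalSpace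

variable {X : Type*} [TopologicalSpace X]

/-- The dimension of `A` is less than `d`; in particular, `d = 0` means that `A` has no irreducible
closed subset at all. -/
def DimLT (A : Set X) (d : ℕ∞) : Prop :=
  ∀ C : IrreducibleCloseds X, (C : Set X) ⊆ A → Order.height C < d

theorem DimLT.eq_empty [T1Space X] {A : Set X} (h : DimLT A 0) : A = ∅ := by
  by_contra hA
  obtain ⟨x, hx⟩ := Set.nonempty_iff_ne_empty.2 hA
  simpa using h {x} (by simpa using hx)

theorem DimLT.finite [T1Space X] [NoetherianSpace X] {A : Set X} (hA : IsClosed A)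
    (h : DimLT A 1) : A.Finite := by
  obtain ⟨S, hS, hcl, hirr, rfl⟩ := NoetherianSpace.exists_finite_set_isClosed_irreducible hA
  refine hS.sUnion fun t ht => Set.Subsingleton.finite fun x hx y hy => ?_
  have hmin := h ⟨t, hirr t ht, hcl t ht⟩ (Set.subset_sUnion_of_mem ht)
  rw [Order.lt_one_iff, Order.height_eq_zero] at hmin
  have hle : ∀ z ∈ t, ({z} : IrreducibleCloseds X) ≤ ⟨t, hirr t ht, hcl t ht⟩ := fun z hz => by
    rintro _ rfl; exact hz
  exact hmin (hle y hy) hx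

/-- A closed set of a Noetherian space contains finitely many points such that removing them lowers
the dimension: one point in each irreducible component. -/
theorem exists_finite_forall_dimLT_inter [NoetherianSpace X] {A : Set X} (hA : IsClosed A) :
    ∃ T : Set X, T.Finite ∧ ∀ H : Set X, (∀ x ∈ T, x ∉ H) →
      ∀ d : ℕ, DimLT A (d + 1 : ℕ) → DimLT (A ∩ H) d := by
  obtain ⟨S, hS, hcl, hirr, rfl⟩ := NoetherianSpace.exists_finite_set_isClosed_irreducible hA
  rcases isEmpty_or_nonempty X with hX | hX
  · exact ⟨∅, Set.finite_empty, fun H _ d _ C => (hX.false C.isIrreducible.nonempty.some).elim⟩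
  choose! x hx using fun t ht => (hirr t ht).nonempty
  refine ⟨x '' S, hS.image x, fun H hH d hd C hC => ?_⟩
  lift S to Finset (Set X) using hS
  obtain ⟨t, ht, hCt⟩ := isIrreducible_iff_sUnion_isClosed.1 C.isIrreducible S hcl
    fun _ hx => (hC hx).1
  have hlt : C < ⟨t, hirr t ht, hcl t ht⟩ := lt_of_le_of_ne hCt fun h => by
    refine hH (x t) ⟨t, ht, rfl⟩ (hC ?_).2
    have : (C : Set X) = t := congrArg SetLike.coe h
    exact this ▸ hx t ht
  have h1 := (Order.height_add_one_le hlt).trans_lt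
    (hd ⟨t, hirr t ht, hcl t ht⟩ (Set.subset_sUnion_of_mem ht))
  push_cast at h1
  exact lt_of_add_lt_add_right h1

/-- The height of an irreducible closed set in the poset of all irreducible closed sets is at most
its Krull dimension. -/
theorem height_le_topologicalKrullDim (Y : IrreducibleCloseds X) :
    (Order.height Y : WithBot ℕ∞) ≤ topologicalKrullDim (Y : Set X) := by
  rw [Order.height_eq_krullDim_Iic]
  let ι : ↥(Y : Set X) → X := Subtype.val
  have himg : ∀ C : Set.Iic Y, ι '' (ι ⁻¹' (C.1 : Set X)) = C.1 := fun C => by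
    rw [Subtype.image_preimage_coe]
    exact Set.inter_eq_right.2 C.2
  refine Order.krullDim_le_of_strictMono (fun C => ⟨ι ⁻¹' (C.1 : Set X), ⟨?_, ?_⟩,
    C.1.isClosed.preimage continuous_subtype_val⟩) fun C C' h => ?_
  · obtain ⟨x, hx⟩ := C.1.isIrreducible.nonempty
    exact ⟨⟨x, C.2 hx⟩, hx⟩
  · rintro _ _ ⟨u, hu, rfl⟩ ⟨v, hv, rfl⟩ ⟨x, hx, hxu⟩ ⟨y, hy, hyv⟩
    obtain ⟨z, hz, hzuv⟩ := C.1.isIrreducible.2 u v hu hv ⟨x, hx, hxu⟩ ⟨y, hy, hyv⟩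
    exact ⟨⟨z, C.2 hz⟩, hz, hzuv⟩
  · refine lt_of_le_not_ge (Set.preimage_mono (f := ι) h.le) fun h' => h.not_ge ?_
    have : ι '' (ι ⁻¹' (C'.1 : Set X)) ⊆ ι '' (ι ⁻¹' (C.1 : Set X)) := Set.image_mono h'
    rwa [himg, himg] at this

end Dimension

/-! ### Linear subspaces of projective space -/

theorem ProjSpace.isClosed_iff {r : ℕ} (Z : Set (ProjSpace r)) :
    IsClosed Z ↔ IsAlgebraicSet (fun p : ProjSpace r => p.rep) Z :=
  isClosed_zariskiTopology _ Z

instance ProjSpace.instNoetherianSpace (r : ℕ) : TopologicalSpace.NoetherianSpace (ProjSpace r) :=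
  noetherianSpace_of_isAlgebraicSet ProjSpace.isClosed_iff

theorem mk_mem_linearSpace {r : ℕ} {L : Submodule ℂ (Fin (r + 1) → ℂ)} {v : Fin (r + 1) → ℂ}
    (hv : v ≠ 0) : Projectivization.mk ℂ v hv ∈ linearSpace L ↔ v ∈ L := by
  change (Projectivization.mk ℂ v hv).submodule ≤ L ↔ _
  rw [Projectivization.submodule_mk, Submodule.span_singleton_le_iff_mem]

theorem mem_linearSpace {r : ℕ} {L : Submodule ℂ (Fin (r + 1) → ℂ)} {p : ProjSpace r} :
    p ∈ linearSpace L ↔ p.rep ∈ L := by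
  rw [← mk_mem_linearSpace p.rep_nonzero, p.mk_rep]

theorem linearSpace_subset_linearSpace {r : ℕ} {L L' : Submodule ℂ (Fin (r + 1) → ℂ)} :
    linearSpace L ⊆ linearSpace L' ↔ L ≤ L' := by
  refine ⟨fun h v hv => ?_, fun h p hp => le_trans hp h⟩
  by_cases hv0 : v = 0
  · exact hv0 ▸ L'.zero_mem
  · exact (mk_mem_linearSpace hv0).1 (h ((mk_mem_linearSpace hv0).2 hv))

theorem isClosed_linearSpace {r : ℕ} (L : Submodule ℂ (Fin (r + 1) → ℂ)) :
    IsClosed (linearSpace L) := by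
  rw [ProjSpace.isClosed_iff]
  refine ⟨{f | ∃ a : Fin (r + 1) → ℂ, (∀ v ∈ L, a ⬝ᵥ v = 0) ∧ f = linearForm a}, ?_, ?_⟩
  · rintro _ ⟨a, -, rfl⟩
    exact ⟨1, isHomogeneous_linearForm a⟩
  · ext p
    rw [mem_linearSpace]
    constructor
    · rintro hp _ ⟨a, ha, rfl⟩
      rw [eval_linearForm, ha _ hp]
    · intro hp
      by_contra h
      obtain ⟨f, hf, hfL⟩ := Submodule.exists_le_ker_of_notMem h
      obtain ⟨a, rfl⟩ := (dotProductEquiv ℂ (Fin (r + 1))).surjective f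
      refine hf ?_
      have := hp _ ⟨a, fun v hv => hfL hv, rfl⟩
      rwa [eval_linearForm] at this

instance ProjSpace.instT1Space (r : ℕ) : T1Space (ProjSpace r) where
  t1 p := by
    convert isClosed_linearSpace p.submodule
    ext q
    refine ⟨fun h => by rw [Set.mem_singleton_iff.1 h]; exact le_refl p.submodule,
      fun h => Projectivization.submodule_injective ?_⟩
    exact Submodule.eq_of_le_of_finrank_eq h (by simp [Projectivization.finrank_submodule])

/-- The affine cone over a set of points of `ℙ^r`; the origin belongs to it by convention, even if
the set is empty. -/
def affineCone {r : ℕ} (Y : Set (ProjSpace r)) : Set (Fin (r + 1) → ℂ) :=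
  {v | ∀ hv : v ≠ 0, Projectivization.mk ℂ v hv ∈ Y}

theorem ProjSpace.exists_eq_smul_rep {r : ℕ} {v : Fin (r + 1) → ℂ} (hv : v ≠ 0) :
    ∃ t : ℂ, t ≠ 0 ∧ v = t • (Projectivization.mk ℂ v hv).rep := by
  obtain ⟨a, ha⟩ := Projectivization.exists_smul_eq_mk_rep ℂ v hv
  exact ⟨(a⁻¹ : ℂˣ), Units.ne_zero _, by rw [← ha, ← Units.smul_def, inv_smul_smul]⟩

theorem mem_affineCone_iff {r : ℕ} {Y : Set (ProjSpace r)} (hY : IsClosed Y) (hne : Y.Nonempty)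
    {v : Fin (r + 1) → ℂ} : v ∈ affineCone Y ↔
      ∀ f ∈ coneIdeal (fun p : ProjSpace r => p.rep) Y, MvPolynomial.eval v f = 0 := by
  by_cases hv : v = 0
  · obtain ⟨x, hx⟩ := hne
    refine iff_of_true (fun h => absurd hv h) fun f hf => ?_
    simpa [hv] using mem_coneIdeal.1 hf x hx 0
  · obtain ⟨t, ht, hvt⟩ := ProjSpace.exists_eq_smul_rep hv
    have := ((ProjSpace.isClosed_iff Y).1 hY).mem_iff (x := Projectivization.mk ℂ v hv) ht
    rw [← hvt] at this
    rw [← this]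
    exact ⟨fun h => h hv, fun h _ => h⟩

/-- A linear subspace is irreducible: two points of it lie on a line, on which two polynomials
that do not vanish identically have a common nonzero. -/
theorem isIrreducible_linearSpace {r : ℕ} {L : Submodule ℂ (Fin (r + 1) → ℂ)} (hL : L ≠ ⊥) :
    IsIrreducible (linearSpace L) := by
  refine ⟨?_, isPreirreducible_iff_isClosed_union_isClosed.2 fun A B hA hB hAB => ?_⟩
  · obtain ⟨v, hv, hv0⟩ := L.exists_mem_ne_zero_of_ne_bot hL
    exact ⟨_, (mk_mem_linearSpace hv0).2 hv⟩
  · by_contra! h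
    obtain ⟨⟨p, hp, hpA⟩, ⟨q, hq, hqB⟩⟩ := And.imp Set.not_subset.1 Set.not_subset.1 h
    have hex : ∀ {Z : Set (ProjSpace r)} {x}, IsClosed Z → x ∉ Z →
        ∃ f ∈ coneIdeal (fun p : ProjSpace r => p.rep) Z, MvPolynomial.eval x.rep f ≠ 0 :=
      fun {Z x} hZ hx => by
        have := mt (((ProjSpace.isClosed_iff Z).1 hZ).mem_iff (x := x) one_ne_zero).2 hx
        simpa using this
    obtain ⟨f, hf, hfp⟩ := hex hA hpA
    obtain ⟨g, hg, hgq⟩ := hex hB hqB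
    obtain ⟨k, hk⟩ := Function.ne_iff.1 p.rep_nonzero
    -- the restrictions of polynomials to the affine line from `p.rep` to `q.rep`
    let γ : Fin (r + 1) → Polynomial ℂ := fun i =>
      Polynomial.C (p.rep i) + Polynomial.X * Polynomial.C (q.rep i - p.rep i)
    let w : ℂ → Fin (r + 1) → ℂ := fun t => p.rep + t • (q.rep - p.rep)
    have hγ : ∀ (f : MvPolynomial (Fin (r + 1)) ℂ) (t : ℂ),
        (MvPolynomial.aeval γ f).eval t = MvPolynomial.eval (w t) f := fun f t => by
      rw [← Polynomial.coe_aeval_eq_eval, MvPolynomial.comp_aeval_apply, MvPolynomial.aeval_eq_eval]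
      congr 2
      ext i
      simp [γ, w]
    have hw0 : w 0 = p.rep := by simp [w]
    have hw1 : w 1 = q.rep := by simp [w]
    have hzero : MvPolynomial.aeval γ (f * g * MvPolynomial.X k) = 0 := by
      refine Polynomial.funext fun t => ?_
      rw [hγ, Polynomial.eval_zero]
      by_cases hw : w t = 0
      · simp [hw]
      have hmem : Projectivization.mk ℂ (w t) hw ∈ linearSpace L := by
        rw [mk_mem_linearSpace]
        rw [mem_linearSpace] at hp hq
        exact L.add_mem hp (L.smul_mem _ (L.sub_mem hq hp))
      obtain ⟨s, -, hs⟩ := ProjSpace.exists_eq_smul_rep hw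
      rcases hAB hmem with h | h
      · rw [map_mul, map_mul, hs, mem_coneIdeal.1 hf _ h, zero_mul, zero_mul]
      · rw [map_mul, map_mul, hs, mem_coneIdeal.1 hg _ h, mul_zero, zero_mul]
    rw [map_mul, map_mul, mul_eq_zero, mul_eq_zero] at hzero
    rcases hzero with (h | h) | h
    · exact hfp (by rw [← hw0, ← hγ, h, Polynomial.eval_zero])
    · exact hgq (by rw [← hw1, ← hγ, h, Polynomial.eval_zero])
    · have := hγ (MvPolynomial.X k) 0
      rw [h, hw0, Polynomial.eval_zero, MvPolynomial.eval_X] at this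
      exact hk this.symm

/-- The irreducible closed subset given by a nonzero vector subspace. -/
def linearIrreducibleCloseds {r : ℕ} (L : Submodule ℂ (Fin (r + 1) → ℂ)) (hL : L ≠ ⊥) :
    TopologicalSpace.IrreducibleCloseds (ProjSpace r) :=
  ⟨linearSpace L, isIrreducible_linearSpace hL, isClosed_linearSpace L⟩

theorem le_height_linearIrreducibleCloseds {r : ℕ} (n : ℕ) (L : Submodule ℂ (Fin (r + 1) → ℂ))
    (hL : L ≠ ⊥) (hn : Module.finrank ℂ L = n + 1) :
    (n : ℕ∞) ≤ Order.height (linearIrreducibleCloseds L hL) := by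
  induction n generalizing L with
  | zero => simp
  | succ n ih =>
    obtain ⟨L', hL', hn'⟩ : ∃ L' ≤ L, Module.finrank ℂ L' = n + 1 := by
      obtain ⟨v, hv, hv0⟩ := L.exists_mem_ne_zero_of_ne_bot hL
      obtain ⟨f, hf⟩ := Module.exists_dual_forall_apply_ne_zero (K := ℂ) (ι := Unit)
        (fun _ => (⟨v, hv⟩ : L)) (by simpa using hv0)
      have hf0 : f ≠ 0 := by rintro rfl; simp at hf
      refine ⟨(LinearMap.ker f).map L.subtype, Submodule.map_subtype_le _ _, ?_⟩
      rw [Submodule.finrank_map_subtype_eq]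
      have := Module.Dual.finrank_ker_add_one_of_ne_zero hf0
      omega
    have hne : L' ≠ ⊥ := by rintro rfl; simp at hn'
    have hlt : linearIrreducibleCloseds L' hne < linearIrreducibleCloseds L hL := by
      refine lt_of_le_not_ge (linearSpace_subset_linearSpace.2 hL') fun h => ?_
      have := Submodule.finrank_mono (linearSpace_subset_linearSpace.1 h)
      omega
    push_cast
    refine le_trans ?_ (Order.height_add_one_le hlt)
    gcongr
    exact ih L' hne hn'

/-! ### Linear sections of closed subsets of projective space -/

/-- The linear space cut out by the linear forms with coefficient vectors `a i`. -/
def commonZeros {r n : ℕ} (a : Fin n → Fin (r + 1) → ℂ) : Set (ProjSpace r) :=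
  {p | ∀ i, a i ⬝ᵥ p.rep = 0}

theorem isClosed_commonZeros {r n : ℕ} (a : Fin n → Fin (r + 1) → ℂ) :
    IsClosed (commonZeros a) := by
  simp only [commonZeros, Set.ofPred_forall]
  refine isClosed_iInter fun i => ?_
  simp only [ProjSpace.isClosed_iff, ← eval_linearForm]
  exact isAlgebraicSet_of_isHomogeneous _ (isHomogeneous_linearForm _)

/-- `n` suitable linear forms lower the dimensions of two given closed sets by `n`. -/
theorem exists_commonZeros_dimLT {r : ℕ} {A B : Set (ProjSpace r)} (hA : IsClosed A)
    (hB : IsClosed B) (n d e : ℕ) (hAd : DimLT A (d + n : ℕ)) (hBe : DimLT B (e + n : ℕ)) :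
    ∃ a : Fin n → Fin (r + 1) → ℂ,
      DimLT (A ∩ commonZeros a) d ∧ DimLT (B ∩ commonZeros a) e := by
  induction n generalizing d e with
  | zero =>
    refine ⟨0, fun C hC => hAd C (hC.trans Set.inter_subset_left),
      fun C hC => hBe C (hC.trans Set.inter_subset_left)⟩
  | succ n ih =>
    obtain ⟨a, haA, haB⟩ := ih (d + 1) (e + 1) (by rwa [add_right_comm]) (by rwa [add_right_comm])
    obtain ⟨S, hS, hSd⟩ := exists_finite_forall_dimLT_inter (hA.inter (isClosed_commonZeros a))
    obtain ⟨T, hT, hTe⟩ := exists_finite_forall_dimLT_inter (hB.inter (isClosed_commonZeros a))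
    have : Finite ↥(S ∪ T) := hS.union hT
    obtain ⟨b, hb⟩ := exists_forall_dotProduct_ne_zero
      (fun p : ↥(S ∪ T) => (p : ProjSpace r).rep) fun p => p.1.rep_nonzero
    have heq : commonZeros (Fin.cons b a : Fin (n + 1) → Fin (r + 1) → ℂ) =
        commonZeros a ∩ {p | b ⬝ᵥ p.rep = 0} := by
      ext p
      simp [commonZeros, Fin.forall_fin_succ, and_comm]
    refine ⟨Fin.cons b a, ?_, ?_⟩ <;> rw [heq, ← Set.inter_assoc]
    · exact hSd _ (fun x hx => hb ⟨x, Or.inl hx⟩) d haA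
    · exact hTe _ (fun x hx => hb ⟨x, Or.inr hx⟩) e haB

/-! ### Vertices of cones -/

/-- The vectors along which the affine cone over `Y` is invariant under translation; if `Y` is
nonempty, their classes are the points `p` such that `Y` is a cone with vertex `p`. -/
def vertexSpace {r : ℕ} (Y : Set (ProjSpace r)) : Submodule ℂ (Fin (r + 1) → ℂ) where
  carrier := {v | ∀ y ∈ affineCone Y, ∀ t : ℂ, y + t • v ∈ affineCone Y}
  add_mem' {v w} hv hw y hy t := by
    rw [smul_add, ← add_assoc]
    exact hw _ (hv y hy t) t
  zero_mem' y hy t := by simpa using hy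
  smul_mem' c v hv y hy t := by
    rw [smul_smul]
    exact hv y hy _

theorem linearSpace_vertexSpace_subset {r : ℕ} (Y : Set (ProjSpace r)) :
    linearSpace (vertexSpace Y) ⊆ Y := by
  intro p hp
  have := mem_linearSpace.1 hp 0 (fun h => absurd rfl h) 1
  rw [zero_add, one_smul] at this
  simpa using this p.rep_nonzero

/-- If linear spaces in `Y` with a common point are dense in `Y`, then `Y` is a cone with that point
as a vertex. -/
theorem mem_vertexSpace_of_subset_closure {r : ℕ} {Y : Set (ProjSpace r)} (hY : IsClosed Y)
    (hne : Y.Nonempty) {v : Fin (r + 1) → ℂ} (F : Set (Submodule ℂ (Fin (r + 1) → ℂ)))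
    (hv : ∀ W ∈ F, v ∈ W) (hF : ∀ W ∈ F, linearSpace W ⊆ Y)
    (hdense : Y ⊆ closure (⋃ W ∈ F, linearSpace W)) : v ∈ vertexSpace Y := by
  have hcone : ∀ W ∈ F, ∀ w ∈ W, w ∈ affineCone Y := fun W hW w hw hw0 =>
    hF W hW ((mk_mem_linearSpace hw0).2 hw)
  -- the translates by multiples of `v` of the polynomials that vanish on the cone over `Y`
  let τ : ℂ → MvPolynomial (Fin (r + 1)) ℂ → MvPolynomial (Fin (r + 1)) ℂ := fun t f =>
    MvPolynomial.aeval (fun i => MvPolynomial.X i + MvPolynomial.C (t * v i)) f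
  have hτ : ∀ t f x, MvPolynomial.eval x (τ t f) = MvPolynomial.eval (x + t • v) f :=
      fun t f x => by
    rw [← MvPolynomial.aeval_eq_eval, MvPolynomial.comp_aeval_apply, MvPolynomial.aeval_eq_eval]
    congr 2
    ext i
    simp
  let K : Set (ProjSpace r) := {q | ∀ g ∈ {g | ∃ f ∈ coneIdeal (fun p : ProjSpace r => p.rep) Y,
    ∃ t, g = τ t f}, ∀ s : ℂ, MvPolynomial.eval (s • q.rep) g = 0}
  have hKcl : IsClosed K := (ProjSpace.isClosed_iff _).2 (isAlgebraicSet_forall_eval_smul _ _)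
  have hYK : Y ⊆ K := by
    refine hdense.trans (closure_minimal (Set.iUnion₂_subset fun W hW q hq => ?_) hKcl)
    rintro _ ⟨f, hf, t, rfl⟩ s
    rw [hτ]
    exact (mem_affineCone_iff hY hne).1 (hcone W hW _ (W.add_mem (W.smul_mem _
      (mem_linearSpace.1 hq)) (W.smul_mem _ (hv W hW)))) f hf
  intro y hy t
  by_cases hy0 : y = 0
  · obtain ⟨q, hq⟩ := closure_nonempty_iff.1 (hne.mono hdense)
    obtain ⟨W, hW, -⟩ := Set.mem_iUnion₂.1 hq
    rw [hy0, zero_add]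
    exact hcone W hW _ (W.smul_mem _ (hv W hW))
  · obtain ⟨s, -, hs⟩ := ProjSpace.exists_eq_smul_rep hy0
    refine (mem_affineCone_iff hY hne).2 fun f hf => ?_
    rw [hs, ← hτ]
    exact hYK (hy hy0) _ ⟨f, hf, t, rfl⟩ s

/-! ### Plücker coordinates -/

namespace ProjGrassmannian

variable {m r : ℕ}

theorem isClosed_iff (Z : Set (ProjGrassmannian m r)) :
    IsClosed Z ↔ IsAlgebraicSet ProjGrassmannian.plucker Z :=
  isClosed_zariskiTopology _ Z

instance instNoetherianSpace (m r : ℕ) : TopologicalSpace.NoetherianSpace (ProjGrassmannian m r) :=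
  noetherianSpace_of_isAlgebraicSet isClosed_iff

theorem frame_mem (W : ProjGrassmannian m r) (i : Fin m) : W.frame i ∈ W.1 :=
  (Module.finBasisOfFinrankEq ℂ W.1 W.2 i).2

theorem linearIndependent_frame (W : ProjGrassmannian m r) : LinearIndependent ℂ W.frame :=
  (Module.finBasisOfFinrankEq ℂ W.1 W.2).linearIndependent.map' W.1.subtype
    (Submodule.ker_subtype _)

theorem exists_eq_sum_frame (W : ProjGrassmannian m r) {x : Fin (r + 1) → ℂ} (hx : x ∈ W.1) :
    ∃ s : Fin m → ℂ, x = ∑ j, s j • W.frame j := by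
  refine ⟨(Module.finBasisOfFinrankEq ℂ W.1 W.2).repr ⟨x, hx⟩, ?_⟩
  have := congrArg Subtype.val ((Module.finBasisOfFinrankEq ℂ W.1 W.2).sum_repr ⟨x, hx⟩)
  rw [Submodule.coe_sum] at this
  exact this.symm

/-- The Plücker coordinates are the coefficients of the determinant of the pairing of the frame with
`m` linear forms. -/
theorem det_dotProduct_frame (W : ProjGrassmannian m r) (a : Fin m → Fin (r + 1) → ℂ) :
    Matrix.det (Matrix.of fun i j => a i ⬝ᵥ W.frame j) =
      (fun I : Fin m → Fin (r + 1) => ∏ i, a i (I i)) ⬝ᵥ W.plucker := by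
  have h1 : (Matrix.of fun i j => a i ⬝ᵥ W.frame j) =
      fun i => ∑ k, a i k • fun j => W.frame j k := by
    ext i j
    simp [dotProduct, Finset.sum_apply]
  rw [h1]
  change Matrix.detRowAlternating.toMultilinearMap _ = _
  rw [MultilinearMap.map_sum, dotProduct]
  refine Finset.sum_congr rfl fun I _ => ?_
  rw [MultilinearMap.map_smul_univ, smul_eq_mul, plucker, ← Matrix.det_transpose]
  rfl

theorem plucker_ne_zero (W : ProjGrassmannian m r) : W.plucker ≠ 0 := by
  intro h
  let b := Module.finBasisOfFinrankEq ℂ W.1 W.2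
  choose g hg using fun i => LinearMap.exists_extend (b.coord i)
  have hdual : ∀ i, ∃ a : Fin (r + 1) → ℂ, ∀ j, a ⬝ᵥ W.frame j = if i = j then 1 else 0 :=
      fun i => by
    obtain ⟨a, ha⟩ := (dotProductEquiv ℂ (Fin (r + 1))).surjective (g i)
    refine ⟨a, fun j => ?_⟩
    have h1 : a ⬝ᵥ W.frame j = g i (W.frame j) := by rw [← ha]; rfl
    have h2 : g i (W.frame j) = b.coord i (b j) := by rw [← hg i]; rfl
    rw [h1, h2, Module.Basis.coord_apply, Module.Basis.repr_self, Finsupp.single_apply]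
    simp only [eq_comm]
  choose a ha using hdual
  have h1 := W.det_dotProduct_frame a
  have h2 : (Matrix.of fun i j => a i ⬝ᵥ W.frame j) = 1 := by
    ext i j
    rw [Matrix.of_apply, ha, Matrix.one_apply]
  rw [h2, h, Matrix.det_one, dotProduct_zero] at h1
  exact one_ne_zero h1

theorem exists_plucker_ne_zero (W : ProjGrassmannian m r) : ∃ I, W.plucker I ≠ 0 :=
  Function.ne_iff.1 W.plucker_ne_zero

/-- The square matrix formed by the columns `I` of the frame. -/
noncomputable def minor (W : ProjGrassmannian m r) (I : Fin m → Fin (r + 1)) :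
    Matrix (Fin m) (Fin m) ℂ :=
  Matrix.of fun i j => W.frame i (I j)

/-- Cramer's rule: replacing one of the columns `I` in a Plücker coordinate yields a linear
combination of the frame. -/
theorem plucker_update (W : ProjGrassmannian m r) (I : Fin m → Fin (r + 1)) (i : Fin m)
    (k : Fin (r + 1)) : W.plucker (Function.update I i k) =
      ∑ j, (W.minor I).adjugate i j * W.frame j k := by
  have h : (Matrix.of fun a j => W.frame a (Function.update I i k j)) =
      (W.minor I).updateCol i (fun a => W.frame a k) := by
    ext a j
    by_cases hj : j = i
    · subst hj; simp
    · simp [hj, minor]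
  rw [plucker, h, ← Matrix.cramer_apply, Matrix.cramer_eq_adjugate_mulVec]
  rfl

theorem plucker_update_mem (W : ProjGrassmannian m r) (I : Fin m → Fin (r + 1)) (i : Fin m) :
    (fun k => W.plucker (Function.update I i k)) ∈ W.1 := by
  have : (fun k => W.plucker (Function.update I i k)) =
      ∑ j, (W.minor I).adjugate i j • W.frame j := by
    ext k
    rw [plucker_update]
    simp [Finset.sum_apply]
  rw [this]
  exact W.1.sum_mem fun j _ => W.1.smul_mem _ (W.frame_mem j)

/-- Linear equations for a linear space, with Plücker coordinates as coefficients. -/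
theorem mem_iff_plucker (W : ProjGrassmannian m r) {x : Fin (r + 1) → ℂ} :
    x ∈ W.1 ↔ ∀ I k, W.plucker I * x k = ∑ i, x (I i) * W.plucker (Function.update I i k) := by
  constructor
  · intro hx I k
    obtain ⟨s, rfl⟩ := W.exists_eq_sum_frame hx
    have h : ∀ l, ∑ i, W.frame l (I i) * W.plucker (Function.update I i k) =
        W.plucker I * W.frame l k := fun l => by
      simp only [plucker_update, Finset.mul_sum, ← mul_assoc]
      rw [Finset.sum_comm]
      simp only [← Finset.sum_mul]
      have h1 : ∀ j, ∑ i, W.frame l (I i) * (W.minor I).adjugate i j =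
          if l = j then W.plucker I else 0 := fun j => by
        have := congrFun (congrFun (Matrix.mul_adjugate (W.minor I)) l) j
        rw [Matrix.mul_apply, Matrix.smul_apply, Matrix.one_apply, smul_eq_mul, mul_ite, mul_one,
          mul_zero] at this
        exact this
      simp [h1]
    simp only [Finset.sum_apply, Pi.smul_apply, smul_eq_mul, Finset.sum_mul, Finset.mul_sum]
    rw [Finset.sum_comm]
    refine Finset.sum_congr rfl fun l _ => ?_
    simp only [mul_assoc, ← Finset.mul_sum]
    rw [h]
    ring
  · intro h
    obtain ⟨I, hI⟩ := W.exists_plucker_ne_zero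
    have : x = (W.plucker I)⁻¹ • ∑ i, x (I i) • fun k => W.plucker (Function.update I i k) := by
      ext k
      rw [Pi.smul_apply, smul_eq_mul, eq_inv_mul_iff_mul_eq₀ hI, h]
      simp [Finset.sum_apply]
    rw [this]
    exact W.1.smul_mem _ (W.1.sum_mem fun i _ => W.1.smul_mem _ (W.plucker_update_mem I i))

theorem isClosed_setOf_mem (x : Fin (r + 1) → ℂ) :
    IsClosed {W : ProjGrassmannian m r | x ∈ W.1} := by
  let rel : (Fin m → Fin (r + 1)) → Fin (r + 1) → MvPolynomial (Fin m → Fin (r + 1)) ℂ :=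
    fun I k => MvPolynomial.X I * MvPolynomial.C (x k) -
      ∑ i, MvPolynomial.C (x (I i)) * MvPolynomial.X (Function.update I i k)
  rw [isClosed_iff]
  convert isAlgebraicSet_forall_eval_smul plucker {f | ∃ I k, f = rel I k} using 1
  ext W
  rw [Set.mem_ofPred_eq, mem_iff_plucker]
  have heval : ∀ I k (t : ℂ), MvPolynomial.eval (t • W.plucker) (rel I k) =
      t * (W.plucker I * x k - ∑ i, x (I i) * W.plucker (Function.update I i k)) := fun I k t => by
    simp only [rel, map_sub, map_mul, map_sum, MvPolynomial.eval_X, MvPolynomial.eval_C,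
      Pi.smul_apply, smul_eq_mul, mul_sub, Finset.mul_sum, mul_assoc, mul_left_comm t]
  constructor
  · rintro h _ ⟨I, k, rfl⟩ t
    rw [heval, h, sub_self, mul_zero]
  · intro h I k
    have := h _ ⟨I, k, rfl⟩ 1
    rwa [heval, one_mul, sub_eq_zero] at this

theorem ne_bot (hm : m ≠ 0) (W : ProjGrassmannian m r) : W.1 ≠ ⊥ := by
  intro h
  have := W.2
  rw [h, finrank_bot] at this
  exact hm this.symm

/-- The linear spaces contained in a closed set form a closed subset of the Grassmannian: they
are parametrized by means of their Plücker coordinates. -/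
theorem isClosed_setOf_space_subset (hm : m ≠ 0) {Y : Set (ProjSpace r)} (hY : IsClosed Y) :
    IsClosed {W : ProjGrassmannian m r | W.space ⊆ Y} := by
  rcases Y.eq_empty_or_nonempty with rfl | hne
  · convert isClosed_empty
    refine Set.eq_empty_of_forall_notMem fun W hW => ?_
    exact (isIrreducible_linearSpace (W.ne_bot hm)).nonempty.not_subset_empty hW
  let φ : (Fin m → Fin (r + 1)) → (Fin m → ℂ) → MvPolynomial (Fin (r + 1)) ℂ →
      MvPolynomial (Fin m → Fin (r + 1)) ℂ := fun I s f =>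
    MvPolynomial.aeval (fun k => ∑ i, MvPolynomial.C (s i) *
      MvPolynomial.X (Function.update I i k)) f
  have hφ : ∀ I s f (W : ProjGrassmannian m r) (t : ℂ),
      MvPolynomial.eval (t • W.plucker) (φ I s f) = MvPolynomial.eval
        (t • ∑ i, s i • fun k => W.plucker (Function.update I i k)) f := fun I s f W t => by
    rw [← MvPolynomial.aeval_eq_eval, MvPolynomial.comp_aeval_apply, MvPolynomial.aeval_eq_eval]
    congr 2
    ext k
    simp [Finset.sum_apply, Finset.mul_sum, mul_left_comm t]
  rw [isClosed_iff]
  convert isAlgebraicSet_forall_eval_smul plucker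
    {g | ∃ f ∈ coneIdeal (fun p : ProjSpace r => p.rep) Y, ∃ I s, g = φ I s f} using 1
  ext W
  rw [Set.mem_ofPred_eq]
  constructor
  · rintro h _ ⟨f, hf, I, s, rfl⟩ t
    rw [hφ]
    refine (mem_affineCone_iff hY hne).1 (fun h0 => h ?_) f hf
    exact (mk_mem_linearSpace h0).2 (W.1.smul_mem _ (W.1.sum_mem fun i _ =>
      W.1.smul_mem _ (W.plucker_update_mem I i)))
  · intro h q hq
    obtain ⟨I, hI⟩ := W.exists_plucker_ne_zero
    have hq' : q.rep = (1 : ℂ) • ∑ i, ((W.plucker I)⁻¹ * q.rep (I i)) •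
        fun k => W.plucker (Function.update I i k) := by
      ext k
      have := W.mem_iff_plucker.1 (mem_linearSpace.1 hq) I k
      rw [one_smul, ← mul_right_inj' hI, this, Finset.sum_apply, Finset.mul_sum]
      refine Finset.sum_congr rfl fun i _ => ?_
      simp only [Pi.smul_apply, smul_eq_mul]
      rw [← mul_assoc, mul_inv_cancel_left₀ hI]
    rw [← one_smul ℂ q.rep] at hq'
    refine (((ProjSpace.isClosed_iff Y).1 hY).mem_iff one_ne_zero).2 fun f hf => ?_
    rw [hq', ← hφ]
    exact h _ ⟨f, hf, I, _, rfl⟩ 1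

/-- Plücker relations of degree `m`, in the form given by Cramer's rule; they are enough to cut out
the Grassmannian. -/
theorem det_plucker_update (W : ProjGrassmannian m r) (I J : Fin m → Fin (r + 1)) :
    Matrix.det (Matrix.of fun i j => W.plucker (Function.update I i (J j))) =
      W.plucker I ^ (m - 1) * W.plucker J := by
  have : (Matrix.of fun i j => W.plucker (Function.update I i (J j))) =
      (W.minor I).adjugate * W.minor J := by
    ext i j
    rw [Matrix.of_apply, plucker_update, Matrix.mul_apply]
    rfl
  rw [this, Matrix.det_mul, Matrix.det_adjugate, Fintype.card_fin]
  rfl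

/-- The Grassmannian is closed in its Plücker embedding: where the coordinate `v I` is nonzero, the
vectors `k ↦ v (Function.update I i k)` span the linear space with Plücker coordinates `v`. -/
theorem exists_eq_smul_plucker (hm : m ≠ 0) {v : (Fin m → Fin (r + 1)) → ℂ} (hv : v ≠ 0)
    (h : ∀ f ∈ coneIdeal (plucker (m := m) (r := r)) Set.univ, MvPolynomial.eval v f = 0) :
    ∃ W : ProjGrassmannian m r, ∃ t : ℂ, v = t • W.plucker := by
  obtain ⟨I, hI⟩ := Function.ne_iff.1 hv
  rw [Pi.zero_apply] at hI
  let w : Fin m → Fin (r + 1) → ℂ := fun i k => v (Function.update I i k)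
  have hdet : ∀ J : Fin m → Fin (r + 1),
      Matrix.det (Matrix.of fun i j => w i (J j)) = v I ^ (m - 1) * v J := fun J => by
    let rel : MvPolynomial (Fin m → Fin (r + 1)) ℂ :=
      Matrix.det (Matrix.of fun i j => MvPolynomial.X (Function.update I i (J j))) -
        MvPolynomial.X I ^ (m - 1) * MvPolynomial.X J
    have heval : ∀ x, MvPolynomial.eval x rel =
        Matrix.det (Matrix.of fun i j => x (Function.update I i (J j))) -
          x I ^ (m - 1) * x J := fun x => by
      simp only [rel, map_sub, map_mul, map_pow, MvPolynomial.eval_X, RingHom.map_det]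
      congr 2
      ext i j
      simp
    have hrel := h rel (mem_coneIdeal.2 fun W _ t => by
      have h1 : (Matrix.of fun i j => (t • W.plucker) (Function.update I i (J j))) =
          t • Matrix.of fun i j => W.plucker (Function.update I i (J j)) := rfl
      rw [heval, h1, Matrix.det_smul, det_plucker_update, Fintype.card_fin, Pi.smul_apply,
        Pi.smul_apply, smul_eq_mul, smul_eq_mul, mul_pow, ← pow_sub_one_mul hm t]
      ring)
    rw [heval, sub_eq_zero] at hrel
    exact hrel
  have hli : LinearIndependent ℂ w := by
    refine LinearIndependent.of_comp (LinearMap.funLeft ℂ ℂ I) ?_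
    refine Matrix.linearIndependent_rows_of_det_ne_zero
      (A := Matrix.of fun i j => w i (I j)) ?_
    rw [hdet]
    exact mul_ne_zero (pow_ne_zero _ hI) hI
  let W : ProjGrassmannian m r := ⟨Submodule.span ℂ (Set.range w), by
    rw [finrank_span_eq_card hli, Fintype.card_fin]⟩
  choose s hs using fun i => W.exists_eq_sum_frame (Submodule.subset_span ⟨i, rfl⟩ : w i ∈ W.1)
  refine ⟨W, (v I ^ (m - 1))⁻¹ * Matrix.det (Matrix.of s), funext fun J => ?_⟩
  have h1 : (Matrix.of fun i j => w i (J j)) = Matrix.of s * W.minor J := by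
    ext i j
    rw [Matrix.of_apply, hs i, Matrix.mul_apply]
    simp [minor, Finset.sum_apply]
  have h2 := hdet J
  rw [h1, Matrix.det_mul] at h2
  rw [Pi.smul_apply, smul_eq_mul, mul_assoc, eq_inv_mul_iff_mul_eq₀ (pow_ne_zero _ hI), ← h2]
  rfl

/-- Meeting the common zeros of `m` linear forms is a linear condition on Plücker coordinates. -/
theorem exists_mem_space_commonZeros (W : ProjGrassmannian m r) (a : Fin m → Fin (r + 1) → ℂ)
    (h : (fun I : Fin m → Fin (r + 1) => ∏ i, a i (I i)) ⬝ᵥ W.plucker = 0) :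
    ∃ p ∈ W.space, p ∈ commonZeros a := by
  rw [← det_dotProduct_frame] at h
  obtain ⟨u, hu, hau⟩ := Matrix.exists_mulVec_eq_zero_iff.2 h
  have hx : ∑ j, u j • W.frame j ≠ 0 := fun h0 =>
    hu (funext (Fintype.linearIndependent_iff.1 W.linearIndependent_frame u h0))
  refine ⟨Projectivization.mk ℂ _ hx, (mk_mem_linearSpace hx).2
    (W.1.sum_mem fun j _ => W.1.smul_mem _ (W.frame_mem j)), fun i => ?_⟩
  obtain ⟨t, ht, hxt⟩ := ProjSpace.exists_eq_smul_rep hx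
  have h1 := congrFun hau i
  have h2 : a i ⬝ᵥ ∑ j, u j • W.frame j = 0 := by
    rw [dotProduct_sum]
    refine Eq.trans (Finset.sum_congr rfl fun j _ => ?_) h1
    rw [dotProduct_smul, smul_eq_mul, mul_comm]
    rfl
  rw [hxt, dotProduct_smul, smul_eq_zero] at h2
  exact h2.resolve_left ht

end ProjGrassmannian

/-! ### Families of linear spaces in a projective variety -/

namespace ProjGrassmannian

variable {m r : ℕ}

theorem isIrreducible_iUnion_space (hm : m ≠ 0) {Z : Set (ProjGrassmannian m r)}
    (hZ : IsIrreducible Z) : IsIrreducible (⋃ W ∈ Z, W.space) := by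
  have hirr : ∀ W : ProjGrassmannian m r, IsIrreducible W.space := fun W =>
    isIrreducible_linearSpace (W.ne_bot hm)
  refine ⟨?_, isPreirreducible_iff_isClosed_union_isClosed.2 fun A B hA hB hAB => ?_⟩
  · obtain ⟨W, hW⟩ := hZ.nonempty
    obtain ⟨p, hp⟩ := (hirr W).nonempty
    exact ⟨p, Set.mem_iUnion₂.2 ⟨W, hW, hp⟩⟩
  · refine (isPreirreducible_iff_isClosed_union_isClosed.1 hZ.2 _ _
      (isClosed_setOf_space_subset hm hA) (isClosed_setOf_space_subset hm hB) fun W hW => ?_).imp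
      Set.iUnion₂_subset Set.iUnion₂_subset
    exact isPreirreducible_iff_isClosed_union_isClosed.1 (hirr W).2 _ _ hA hB
      ((Set.subset_biUnion_of_mem hW).trans hAB)

/-- An irreducible family of `(m - 1)`-dimensional linear spaces in `Y` with more than one member
sweeps out a dense subset of `Y`: the closure of the union is irreducible and strictly contains a
linear space of dimension `m - 1`. -/
theorem subset_closure_iUnion_space (hm : m ≠ 0)
    {Y : TopologicalSpace.IrreducibleCloseds (ProjSpace r)} (hY : Order.height Y ≤ m)
    {Z : Set (ProjGrassmannian m r)} (hZ : IsIrreducible Z) (hZ2 : Z.Nontrivial)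
    (hZY : ∀ W ∈ Z, W.space ⊆ Y) : (Y : Set (ProjSpace r)) ⊆ closure (⋃ W ∈ Z, W.space) := by
  let U : TopologicalSpace.IrreducibleCloseds (ProjSpace r) :=
    ⟨_, (isIrreducible_iUnion_space hm hZ).closure, isClosed_closure⟩
  have hUY : U ≤ Y := closure_minimal (Set.iUnion₂_subset hZY) Y.isClosed
  obtain ⟨W, hW, W', hW', hne⟩ := hZ2
  have hsub : ∀ W ∈ Z, W.space ⊆ U := fun W hW =>
    (Set.subset_biUnion_of_mem (u := fun W => W.space) hW).trans subset_closure
  have hlt : linearIrreducibleCloseds W.1 (W.ne_bot hm) < U := by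
    refine lt_of_le_not_ge (hsub W hW) fun h => hne (Subtype.ext ?_)
    have hle : W'.1 ≤ W.1 := linearSpace_subset_linearSpace.1 ((hsub W' hW').trans h)
    exact (Submodule.eq_of_le_of_finrank_eq hle (W'.2.trans W.2.symm)).symm
  obtain ⟨n, rfl⟩ := Nat.exists_eq_succ_of_ne_zero hm
  by_contra hYU
  have hUY' : U < Y := lt_of_le_not_ge hUY hYU
  have h1 : ((n + 1 + 1 : ℕ) : ℕ∞) ≤ (n + 1 : ℕ) := by
    refine le_trans ?_ ((Order.height_add_one_le hUY').trans hY)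
    push_cast
    gcongr
    refine le_trans ?_ (Order.height_add_one_le hlt)
    gcongr
    exact le_height_linearIrreducibleCloseds n _ _ W.2
  rw [Nat.cast_le] at h1
  omega

end ProjGrassmannian

theorem mainTheorem9 (r m : ℕ) (hm : 2 ≤ m)
    (Y : Set (ProjSpace r)) (hY_closed : IsClosed Y) (hY_irred : IsIrreducible Y)
    (hY_dim : topologicalKrullDim Y = m)
    (R : Set (ProjGrassmannian m r)) (hR_dim : topologicalKrullDim R = 2)
    (hRY : ∀ W ∈ R, W.space ⊆ Y) :
    ∃ L : Submodule ℂ (Fin (r + 1) → ℂ), Y = linearSpace L := by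
  have hm0 : m ≠ 0 := by omega
  let Y' : TopologicalSpace.IrreducibleCloseds (ProjSpace r) := ⟨Y, hY_irred, hY_closed⟩
  have hY' : Order.height Y' ≤ m := by
    have := height_le_topologicalKrullDim Y'
    exact WithBot.coe_le_coe.1 (this.trans hY_dim.le)
  refine ⟨vertexSpace Y, ?_⟩
  by_contra hYV
  -- `m` linear forms with only finitely many common zeros on `Y`, none of them a vertex of `Y`
  obtain ⟨a, haY, haV⟩ := exists_commonZeros_dimLT hY_closed (isClosed_linearSpace (vertexSpace Y))
    m 1 0 (fun C hC => by
      refine (Order.height_mono (show C ≤ Y' from hC)).trans_lt (hY'.trans_lt ?_)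
      exact Nat.cast_lt.2 (by omega)) fun C hC => by
      have hlt : C < Y' := by
        refine lt_of_le_of_ne (hC.trans (linearSpace_vertexSpace_subset Y)) ?_
        rintro rfl
        exact hYV (hC.antisymm (linearSpace_vertexSpace_subset Y))
      have h1 := (Order.height_add_one_le hlt).trans hY'
      rw [zero_add]
      exact (ENat.add_one_le_iff (ne_top_of_le_ne_top (ENat.natCast_ne_top m)
        (le_self_add.trans h1))).1 h1
  have hfin := DimLT.finite (hY_closed.inter (isClosed_commonZeros a)) haY
  have hempty := DimLT.eq_empty haV
  -- the closures in the Grassmannian of a chain of irreducible closed subsets of `R`; their members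
  -- are still contained in `Y`
  obtain ⟨l, hl⟩ := Order.le_krullDim_iff.1 (show ((2 : ℕ) : WithBot ℕ∞) ≤ _ from hR_dim.ge)
  let Z : Fin (l.length + 1) → TopologicalSpace.IrreducibleCloseds (ProjGrassmannian m r) :=
    fun i => TopologicalSpace.IrreducibleCloseds.map Subtype.val continuous_subtype_val (l i)
  have hZ : StrictMono Z := (TopologicalSpace.IrreducibleCloseds.map_strictMono_of_isInducing
    Topology.IsInducing.subtypeVal).comp l.strictMono
  have hZY : ∀ i, ∀ W ∈ Z i, W.space ⊆ Y := fun i =>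
    closure_minimal (by rintro _ ⟨W, -, rfl⟩; exact hRY W W.2)
      (ProjGrassmannian.isClosed_setOf_space_subset hm0 hY_closed)
  -- by `det_dotProduct_frame`, this linear form vanishes at `W` if and only if the forms `a` have a
  -- common zero on `W.space`
  let b : (Fin m → Fin (r + 1)) → ℂ := fun I => ∏ i, a i (I i)
  let T : Set (ProjGrassmannian m r) := {W | W ∈ Z ⟨2, by omega⟩ ∧ b ⬝ᵥ W.plucker = 0}
  have hT : T.Infinite := infinite_inter_hyperplane ProjGrassmannian.isClosed_iff
    ProjGrassmannian.plucker_ne_zero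
    (fun v hv h => ProjGrassmannian.exists_eq_smul_plucker hm0 hv h)
    (hZ (a := ⟨0, by omega⟩) (b := ⟨1, by omega⟩) (Fin.mk_lt_mk.2 (by omega)))
    (hZ (a := ⟨1, by omega⟩) (b := ⟨2, by omega⟩) (Fin.mk_lt_mk.2 (by omega))) b
  have hTcl : IsClosed T := by
    refine (Z _).isClosed.inter ((ProjGrassmannian.isClosed_iff _).2 ?_)
    simp only [← eval_linearForm]
    exact isAlgebraicSet_of_isHomogeneous _ (isHomogeneous_linearForm b)
  obtain ⟨S, hS, hcl, hirr, hTS⟩ :=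
    TopologicalSpace.NoetherianSpace.exists_finite_set_isClosed_irreducible hTcl
  obtain ⟨t, ht, htinf⟩ : ∃ t ∈ S, t.Infinite := by
    by_contra! h
    exact hT (hTS ▸ hS.sUnion h)
  have htT : t ⊆ T := hTS ▸ Set.subset_sUnion_of_mem ht
  -- all members of `t` contain the same point of the finite section of `Y`
  classical
  obtain ⟨_, hp, htp⟩ := isIrreducible_iff_sUnion_isClosed.1 (hirr t ht)
    (hfin.toFinset.image fun p => {W : ProjGrassmannian m r | p.rep ∈ W.1})
    (fun s hs => by
      obtain ⟨p, -, rfl⟩ := Finset.mem_image.1 hs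
      exact ProjGrassmannian.isClosed_setOf_mem _)
    (fun W hW => by
      obtain ⟨p, hpW, hpa⟩ := W.exists_mem_space_commonZeros a (htT hW).2
      exact ⟨_, Finset.mem_coe.2 (Finset.mem_image_of_mem _
        (hfin.mem_toFinset.2 ⟨hZY _ W (htT hW).1 hpW, hpa⟩)), mem_linearSpace.1 hpW⟩)
  obtain ⟨p, hpY, rfl⟩ := Finset.mem_image.1 hp
  have hpV : p.rep ∈ vertexSpace Y := by
    refine mem_vertexSpace_of_subset_closure hY_closed hY_irred.nonempty
      ((fun W : ProjGrassmannian m r => W.1) '' t) ?_ ?_ ?_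
    · rintro _ ⟨W, hW, rfl⟩
      exact htp hW
    · rintro _ ⟨W, hW, rfl⟩
      exact hZY _ W (htT hW).1
    · rw [Set.biUnion_image]
      exact ProjGrassmannian.subset_closure_iUnion_space (Y := Y') hm0 hY' (hirr t ht)
        htinf.nontrivial fun W hW => hZY _ W (htT hW).1
  exact Set.notMem_empty p (hempty ▸ ⟨mem_linearSpace.2 hpV, (hfin.mem_toFinset.1 hpY).2⟩)
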